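/- Let $\Gamma$ be a countable group acting by automorphisms on a tree $\mathcal{T}$. Suppose that: 1. the action is minimal: there is no non-empty proper $\Gamma$-invariant subtree of $\mathcal{T}$; 2. the action is of general type: $\Gamma$ contains two elements acting on $\mathcal{T}$ as hyperbolic automorphisms (that is, each acts as a non-trivial translation on some bi-infinite geodesic path) which have no common fixed point in the boundary $\partial\mathcal{T}$; 3. the induced action of $\Gamma$ on $\partial\mathcal{T}$ is topologically free: the trivial element is the only element of $\Gamma$ which fixes a non-empty open subset of $\partial\mathcal{T}$ pointwise. Here $\partial\mathcal{T}$ is the set of geodesic rays of $\mathcal{T}$, two rays being identified when their ranges differ by a finite set. Its topology is generated by the sets $U_{\mathcal{H}}$ of classes of geodesic rays contained in $\mathcal{H}$, where $\mathcal{H}$ ranges over the half-trees: the half-tree of an oriented edge $e$ is the subtree consisting of all edges lying on reduced paths whose first edge is $e$. Then $\Gamma$ admits an action on a countably infinite set $X$ that is both highly transitive (for every $k\geq 1$ and all $k$-tuples $(x_1,\dots,x_k)$, $(y_1,\dots,y_k)$ of pairwise distinct points of $X$, some element of $\Gamma$ sends $x_i$ to $y_i$ for every $i=1,\dots,k$)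 and highly faithful (for every finite $F\subseteq \Gamma\setminus\{1\}$, the intersection of the supports $\{x\in X : f \text{ moves } x\}$, $f\in F$, is infinite). In particular, $\Gamma$ is highly transitive, that is, it admits a faithful highly transitive action on a countably infinite set. -/

import Mathlib

namespace TreeAct

/-! ### Geodesics and the boundary of a tree -/

section Boundary

variable {V : Type*}

/-- A geodesic ray: an infinite path `ω` such that the distance between `ω i` and `ω j`
is `|j - i|` for all `i`, `j` (so consecutive vertices are adjacent). -/
structure GeodesicRay (T : SimpleGraph V) where
  /-- the sequence of vertices of the ray -/
  toFun : ℕ → V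
  dist_eq : ∀ i j : ℕ, (T.dist (toFun i) (toFun j) : ℤ) = |(j : ℤ) - (i : ℤ)|

/-- The set of vertices of a geodesic ray. -/
def GeodesicRay.range {T : SimpleGraph V} (ω : GeodesicRay T) : Set V :=
  Set.range ω.toFun

/-- Two geodesic rays are equivalent when their ranges differ by a finite set. -/
instance raySetoid (T : SimpleGraph V) : Setoid (GeodesicRay T) where
  r ω ω' := (symmDiff ω.range ω'.range).Finite
  iseqv :=
    { refl := fun ω => by simp
      symm := fun {ω ω'} h => by rwa [symmDiff_comm]
      trans := fun {ω ω' ω''} h h' =>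
        (h.union h').subset (symmDiff_triangle ω.range ω'.range ω''.range) }

/-- The boundary (set of ends) of a tree. -/
def Boundary (T : SimpleGraph V) : Type _ := Quotient (raySetoid T)

/-- The end of the tree defined by a geodesic ray. -/
def GeodesicRay.toBoundary {T : SimpleGraph V} (ω : GeodesicRay T) : Boundary T :=
  Quotient.mk (raySetoid T) ω

/-- (The vertex set of) the half-tree of the oriented edge `e`: the source of `e` together with
all vertices that are reached by a path without repeated vertices whose first edge is `e`. -/
def halfTree (T : SimpleGraph V) (e : T.Dart) : Set V :=
  insert e.fst {w | ∃ p : T.Walk e.snd w, (SimpleGraph.Walk.cons e.adj p).IsPath}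

/-- The set of ends represented by a geodesic ray contained in the half-tree of `e`. -/
def shadow (T : SimpleGraph V) (e : T.Dart) : Set (Boundary T) :=
  {ξ | ∃ ω : GeodesicRay T, ω.toBoundary = ξ ∧ ω.range ⊆ halfTree T e}

/-- The topology on the boundary, generated by the sets of ends of the half-trees. -/
instance boundaryTopology (T : SimpleGraph V) : TopologicalSpace (Boundary T) :=
  TopologicalSpace.generateFrom (Set.range (shadow T))

/-- Automorphisms preserve the graph distance. -/
theorem dist_aut {T : SimpleGraph V} (g : T ≃g T) (v w : V) :
    T.dist (g v) (g w) = T.dist v w := by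
  have key : ∀ (f : T ≃g T) (v w : V), T.Reachable v w → T.dist (f v) (f w) ≤ T.dist v w := by
    intro f v w h
    obtain ⟨p, hp⟩ := h.exists_walk_length_eq_dist
    rw [← hp, ← SimpleGraph.Walk.length_map f.toHom p]
    exact SimpleGraph.dist_le (p.map f.toHom)
  by_cases h : T.Reachable v w
  · refine le_antisymm (key g v w h) ?_
    have h2 := key g.symm (g v) (g w) (h.map g.toHom)
    simpa using h2
  · have h' : ¬ T.Reachable (g v) (g w) := fun h2 => h (by simpa using h2.map g.symm.toHom)
    rw [SimpleGraph.dist_eq_zero_of_not_reachable h, SimpleGraph.dist_eq_zero_of_not_reachable h']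

/-- The image of a geodesic ray under an automorphism. -/
def GeodesicRay.map {T : SimpleGraph V} (g : T ≃g T) (ω : GeodesicRay T) : GeodesicRay T where
  toFun n := g (ω.toFun n)
  dist_eq i j := by rw [dist_aut]; exact ω.dist_eq i j

/-- The self-map of the boundary induced by an automorphism of the tree. -/
def boundaryMap {T : SimpleGraph V} (g : T ≃g T) : Boundary T → Boundary T :=
  Quotient.map (GeodesicRay.map g) (by
    intro ω ω' h
    have hr : ∀ η : GeodesicRay T, (η.map g).range = g '' η.range := fun η =>
      Set.range_comp g η.toFun
    change (symmDiff (ω.map g).range (ω'.map g).range).Finite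
    rw [hr, hr, ← Set.image_symmDiff g.injective]
    exact Set.Finite.image g h)

end Boundary

/-! ### Actions on trees -/

section Actions

variable {Γ V : Type*} [Group Γ] {T : SimpleGraph V}

/-- An automorphism is hyperbolic if it acts as a non-trivial translation on some bi-infinite
geodesic path. -/
def IsHyperbolic (g : T ≃g T) : Prop :=
  ∃ a : ℤ → V, (∀ i j : ℤ, (T.dist (a i) (a j) : ℤ) = |j - i|) ∧
    ∃ l : ℤ, l ≠ 0 ∧ ∀ n : ℤ, g (a n) = a (n + l)

/-- Two automorphisms are transverse hyperbolic if both are hyperbolic and they have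
no common fixed point in the boundary. -/
def AreTransverse (g h : T ≃g T) : Prop :=
  IsHyperbolic g ∧ IsHyperbolic h ∧ ∀ ξ : Boundary T, ¬ (boundaryMap g ξ = ξ ∧ boundaryMap h ξ = ξ)

/-- An action by automorphisms on a tree is of general type if some two group elements
act as transverse hyperbolic automorphisms. -/
def IsGeneralType (ρ : Γ →* (T ≃g T)) : Prop :=
  ∃ g h : Γ, AreTransverse (ρ g) (ρ h)

/-- An action on a tree is minimal if the only (non-empty) invariant subtree is the whole tree. -/
def IsMinimalAction (ρ : Γ →* (T ≃g T)) : Prop :=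
  ∀ S : Set V, (T.induce S).IsTree → (∀ g : Γ, ∀ v ∈ S, ρ g v ∈ S) → S = Set.univ

/-- The induced action on the boundary is topologically free if only the trivial group element
fixes some non-empty open subset of the boundary pointwise. -/
def IsTopologicallyFreeOnBoundary (ρ : Γ →* (T ≃g T)) : Prop :=
  ∀ g : Γ, ∀ U : Set (Boundary T), IsOpen U → U.Nonempty →
    (∀ ξ ∈ U, boundaryMap (ρ g) ξ = ξ) → g = 1

end Actions

/-! ### Highly transitive and highly faithful actions -/

section SetActions

variable (Γ : Type*) [Group Γ]

/-- An action is highly transitive if any `k`-tuple of pairwise distinct points can be sent to any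
other such `k`-tuple by a group element, for every `k`. -/
def IsHighlyTransitive (X : Type*) [MulAction Γ X] : Prop :=
  ∀ k : ℕ, ∀ x y : Fin k → X, Function.Injective x → Function.Injective y →
    ∃ g : Γ, ∀ i, g • x i = y i

/-- An action is highly faithful if the supports of any finitely many non-trivial group elements
have infinite intersection. -/
def IsHighlyFaithful (X : Type*) [MulAction Γ X] : Prop :=
  ∀ F : Finset Γ, (1 : Γ) ∉ F → {x : X | ∀ g ∈ F, g • x ≠ x}.Infinite

/-- A group is highly transitive if it has a faithful highly transitive action on a countably
infinite set. -/
def IsHighlyTransitiveGroup : Prop :=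
  ∃ (X : Type) (_ : Countable X) (_ : Infinite X) (_ : MulAction Γ X),
    FaithfulSMul Γ X ∧ IsHighlyTransitive Γ X

end SetActions

end TreeAct

/-!
The action is found on the cosets of a subgroup `Δ` of `Γ` built by finite approximations, and the
tree enters only through its half-trees, regarded as sets of vertices.

Write `side T u v` for the half-tree of an edge. Minimality and general type imply that the
complement of any half-tree can be mapped into any other half-tree
(`exists_smul_compl_side_subset`): by minimality some translate of an edge of the axis of a hyperbolic element has a side in the target,
and since neither end of the axis is fixed by `Γ`, both sides of that edge can be moved off
themselves, so that either side can be used. Topological freeness says that every non-trivial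
element moves arbitrarily small half-trees off themselves (`exists_disjoint_smul_side`).

A subgroup `Δ` is called thin if, for all finite `X ⊆ Γ`, arbitrarily small half-trees are moved off
themselves by all the non-trivial elements of `X Δ X⁻¹`. The trivial subgroup is thin. The main step
is `Thin.exists_extension`: if the cosets `x i * Δ` are distinct, and so are the cosets `y i * Δ`,
then a small half-tree `K` has disjoint translates under all the `(x i)⁻¹` and `Δ`, and similarly for
the `y i`. Choose disjoint half-trees `K₁, K₂ ⊆ K` and `g` mapping the complement of `K₁` onto `K₂`.
The elements `(y i)⁻¹ * g * x i` then play ping-pong together with `Δ`, and adjoining them to `Δ`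
forces `g` to map the coset of `x i` to that of `y i`. The enlarged group is thin again
(`PingPong.thin_group`), since each half-tree contains one that lies in a single tile of the
ping-pong (`PingPong.exists_subset_tile`) and distinct tiles are disjoint. Moreover, the new group
can be kept away from finitely many prescribed elements outside `Δ`.

By `Thin.exists_moved_coset` one can always find new cosets moved by finitely many given non-trivial
elements. A sequence of approximations (a thin subgroup together with a finite set of elements to be
avoided) meeting the countably many requirements gives, in the union, a subgroup `Δ` such that the
action on `Γ ⧸ Δ` is highly transitive and highly faithful, and `Γ ⧸ Δ` is infinite.
-/

namespace TreeAct

open Pointwise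

/-! ### Half-space families -/

section HalfSpaces

variable {Γ V : Type*} [Group Γ] [MulAction Γ V]

/-- The properties of the family of half-trees of a tree on which the argument rests. A family `𝓗`
of subsets of `V`, invariant under an action of `Γ`, closed under complements and pairwise nested,
such that every half-space can be shrunk into any other (`proximal`), and every non-trivial group
element moves some half-space inside any given one off itself (`displace`). Some non-trivial element
maps a half-space into itself (`shift`), as hyperbolic elements do; with `displace`, this yields
disjoint half-spaces inside each half-space. The field `gate` records the only metric input: a half-space `H` has an entry point
`v` which is closer to the points of `H` than the points outside `H` are, and which lies in no
smaller half-space inside `H`. -/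
structure HalfSpaceFamily (Γ : Type*) {V : Type*} [Group Γ] [MulAction Γ V]
    (𝓗 : Set (Set V)) : Prop where
  nonempty : ∀ H ∈ 𝓗, H.Nonempty
  compl_mem : ∀ H ∈ 𝓗, Hᶜ ∈ 𝓗
  smul_mem : ∀ g : Γ, ∀ H ∈ 𝓗, g • H ∈ 𝓗
  nested : ∀ H ∈ 𝓗, ∀ K ∈ 𝓗, H ⊆ K ∨ K ⊆ H ∨ Disjoint H K ∨ Hᶜ ⊆ K
  proximal : ∀ H ∈ 𝓗, ∀ K ∈ 𝓗, ∃ g : Γ, g • Hᶜ ⊆ K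
  displace : ∀ g : Γ, g ≠ 1 → ∀ H ∈ 𝓗, ∃ K ∈ 𝓗, K ⊆ H ∧ Disjoint (g • K) K
  shift : ∃ g : Γ, g ≠ 1 ∧ ∃ H ∈ 𝓗, g • H ⊆ H
  gate : ∃ d : V → V → ℕ, ∀ H ∈ 𝓗, ∃ v ∈ H, (∀ x ∉ H, ∀ m ∈ H, d v m < d x m) ∧
    ∀ K ∈ 𝓗, K ⊆ H → v ∈ K → K = H

namespace HalfSpaceFamily

variable {𝓗 : Set (Set V)}

theorem proximal' (h𝓗 : HalfSpaceFamily Γ 𝓗) {H K : Set V} (hH : H ∈ 𝓗) (hK : K ∈ 𝓗) :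
    ∃ g : Γ, g • H ⊆ K := by
  simpa using h𝓗.proximal Hᶜ (h𝓗.compl_mem H hH) K hK

/-- A translate into `H` of a half-space shifted into itself contains some `K` which the shift moves
off itself; both `K` and its image lie in `H`. -/
theorem exists_disjoint_pair (h𝓗 : HalfSpaceFamily Γ 𝓗) {H : Set V} (hH : H ∈ 𝓗) :
    ∃ K ∈ 𝓗, ∃ L ∈ 𝓗, K ⊆ H ∧ L ⊆ H ∧ Disjoint K L := by
  obtain ⟨g, hg, H₀, hH₀, hgH₀⟩ := h𝓗.shift
  obtain ⟨μ, hμ⟩ := h𝓗.proximal' hH₀ hH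
  obtain ⟨K, hK, hKH, hdisj⟩ := h𝓗.displace (μ * g * μ⁻¹) (by simpa using hg) (μ • H₀)
    (h𝓗.smul_mem μ _ hH₀)
  refine ⟨K, hK, _, h𝓗.smul_mem _ _ hK, hKH.trans hμ, ?_, hdisj.symm⟩
  calc (μ * g * μ⁻¹) • K ⊆ (μ * g * μ⁻¹) • (μ • H₀) := Set.smul_set_mono hKH
    _ = μ • (g • H₀) := by simp [smul_smul]
    _ ⊆ H := (Set.smul_set_mono hgH₀).trans hμ

theorem exists_not_superset (h𝓗 : HalfSpaceFamily Γ 𝓗) (S : Set (Set V)) (hS : S.Finite)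
    (hne : ∀ Q ∈ S, Q.Nonempty)
    {H : Set V} (hH : H ∈ 𝓗) : ∃ K ∈ 𝓗, K ⊆ H ∧ ∀ Q ∈ S, ¬ Q ⊆ K := by
  induction S, hS using Set.Finite.induction_on with
  | empty => exact ⟨H, hH, subset_rfl, by simp⟩
  | @insert Q S _ _ ih =>
    obtain ⟨K, hK, hKH, hKS⟩ := ih fun P hP => hne P (Set.mem_insert_of_mem _ hP)
    obtain ⟨A, hA, B, hB, hAK, hBK, hAB⟩ := h𝓗.exists_disjoint_pair hK
    obtain ⟨q, hq⟩ := hne Q (Set.mem_insert _ _)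
    by_cases hQ : Q ⊆ A
    · refine ⟨B, hB, hBK.trans hKH, ?_⟩
      rintro P (rfl | hP) hPB
      · exact Set.disjoint_left.1 hAB (hQ hq) (hPB hq)
      · exact hKS P hP (hPB.trans hBK)
    · refine ⟨A, hA, hAK.trans hKH, ?_⟩
      rintro P (rfl | hP) hPA
      · exact hQ hPA
      · exact hKS P hP (hPA.trans hAK)

theorem exists_displaced (h𝓗 : HalfSpaceFamily Γ 𝓗) (F : Set Γ) (hF : F.Finite) {H : Set V}
    (hH : H ∈ 𝓗) :
    ∃ K ∈ 𝓗, K ⊆ H ∧ ∀ s ∈ F, s ≠ 1 → Disjoint (s • K) K := by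
  induction F, hF using Set.Finite.induction_on with
  | empty => exact ⟨H, hH, subset_rfl, by simp⟩
  | @insert g S _ _ ih =>
    obtain ⟨K, hK, hKH, hKS⟩ := ih
    by_cases hg : g = 1
    · refine ⟨K, hK, hKH, ?_⟩
      rintro s (rfl | hs) h1
      · exact absurd hg h1
      · exact hKS s hs h1
    · obtain ⟨L, hL, hLK, hd⟩ := h𝓗.displace g hg K hK
      refine ⟨L, hL, hLK.trans hKH, ?_⟩
      rintro s (rfl | hs) h1
      · exact hd
      · exact (hKS s hs h1).mono (Set.smul_set_mono hLK) hLK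

end HalfSpaceFamily

/-- A subgroup `Δ` is thin if, for every finite `X ⊆ Γ`, each half-space contains a half-space that
is moved off itself by all the non-trivial elements of `X Δ X⁻¹`. -/
def Thin (𝓗 : Set (Set V)) (Δ : Subgroup Γ) : Prop :=
  ∀ X : Set Γ, X.Finite → ∀ H ∈ 𝓗, ∃ K ∈ 𝓗, K ⊆ H ∧
    ∀ x ∈ X, ∀ y ∈ X, ∀ δ ∈ Δ, x * δ * y⁻¹ ≠ 1 → Disjoint ((x * δ * y⁻¹) • K) K

theorem HalfSpaceFamily.thin_bot {𝓗 : Set (Set V)} (h𝓗 : HalfSpaceFamily Γ 𝓗) :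
    Thin 𝓗 (⊥ : Subgroup Γ) := by
  intro X hX H hH
  obtain ⟨K, hK, hKH, hd⟩ := h𝓗.exists_displaced (Set.image2 (fun x y => x * y⁻¹) X X)
    (hX.image2 _ hX) hH
  refine ⟨K, hK, hKH, fun x hx y hy δ hδ h1 => ?_⟩
  rw [Subgroup.mem_bot] at hδ
  subst hδ
  rw [mul_one] at h1 ⊢
  exact hd _ ⟨x, hx, y, hy, rfl⟩ h1

end HalfSpaces

/-! ### Ping-pong -/

section PingPong

variable {Γ V : Type*} [Group Γ] [MulAction Γ V]

/-- Ping-pong data for the subgroup `Δ`: letters `t c`, closed under inversion `c ↦ inv c` of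
labels, and half-spaces `C c` all of whose `Δ`-translates are pairwise disjoint, such that `t c` maps the
complement of `C (inv c)` *onto* `C c`. A further half-space `Z` avoids all these translates. -/
structure PingPong (𝓗 : Set (Set V)) (Δ : Subgroup Γ) (I : Type*) where
  /-- the formal inverse of a label -/
  inv : I → I
  /-- the group element of a label -/
  t : I → Γ
  /-- the half-space of a label -/
  C : I → Set V
  /-- a half-space outside all translates of the `C c` -/
  Z : Set V
  inv_ne : ∀ c, inv c ≠ c
  inv_inv : ∀ c, inv (inv c) = c
  t_inv : ∀ c, t (inv c) = (t c)⁻¹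
  smul_compl : ∀ c, t c • (C (inv c))ᶜ = C c
  C_mem : ∀ c, C c ∈ 𝓗
  Z_mem : Z ∈ 𝓗
  disj : ∀ δ ∈ Δ, ∀ c c', ¬ Disjoint (δ • C c) (C c') → δ = 1 ∧ c = c'
  Z_disj : ∀ δ ∈ Δ, ∀ c, Disjoint Z (δ • C c)

namespace PingPong

variable {𝓗 : Set (Set V)} {Δ : Subgroup Γ} {I : Type*} (P : PingPong 𝓗 Δ I)

/-- The subgroup generated by `Δ` and the letters. -/
def group : Subgroup Γ := Δ ⊔ Subgroup.closure (Set.range P.t)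

/-- The complement of all `Δ`-translates of the half-spaces `C c`. Its translates under `P.group`
are the tiles of the ping-pong. -/
def domain : Set V := {v | ∀ δ ∈ Δ, ∀ c, v ∉ δ • P.C c}

/-- `Reduced h o` says that `h` is the value of a reduced word in the letters and elements of `Δ`;
here `o` is `none` for words without letters, and `some (δ, c)` for words starting with `δ * t c`. -/
inductive Reduced : Γ → Option (Γ × I) → Prop
  | base (δ : Γ) (hδ : δ ∈ Δ) : Reduced δ none
  | cons (δ : Γ) (hδ : δ ∈ Δ) (c : I) (h : Γ) (o : Option (Γ × I)) (hh : Reduced h o)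
      (ho : o ≠ some (1, P.inv c)) : Reduced (δ * P.t c * h) (some (δ, c))

theorem le_group : Δ ≤ P.group := le_sup_left

theorem t_mem (c : I) : P.t c ∈ P.group :=
  (le_sup_right : _ ≤ P.group) (Subgroup.subset_closure ⟨c, rfl⟩)

variable {P} in
theorem Reduced.smul_left {h : Γ} {o : Option (Γ × I)} (hh : P.Reduced h o) {δ : Γ} (hδ : δ ∈ Δ) :
    ∃ o', P.Reduced (δ * h) o' := by
  cases hh with
  | base δ' hδ' => exact ⟨_, .base _ (mul_mem hδ hδ')⟩
  | cons δ' hδ' c h o hh ho =>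
    refine ⟨some (δ * δ', c), ?_⟩
    have := Reduced.cons (δ * δ') (mul_mem hδ hδ') c h o hh ho
    simpa [mul_assoc] using this

variable {P} in
theorem Reduced.letter_left {h : Γ} {o : Option (Γ × I)} (hh : P.Reduced h o) (c : I) :
    ∃ o', P.Reduced (P.t c * h) o' := by
  by_cases ho : o = some (1, P.inv c)
  · subst ho
    cases hh with
    | cons _ _ _ h' o' hh' ho' =>
      refine ⟨o', ?_⟩
      simpa [P.t_inv] using hh'
  · have := Reduced.cons 1 (one_mem Δ) c h o hh ho
    exact ⟨_, by simpa using this⟩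

theorem exists_reduced {h : Γ} (hh : h ∈ P.group) : ∃ o, P.Reduced h o := by
  have hgen : P.group = Subgroup.closure ((Δ : Set Γ) ∪ Set.range P.t) := by
    rw [Subgroup.closure_union, Subgroup.closure_eq, group]
  rw [hgen] at hh
  induction hh using Subgroup.closure_induction_left with
  | one => exact ⟨none, .base 1 (one_mem _)⟩
  | mul_left x hx y hy ih =>
    obtain ⟨o, ho⟩ := ih
    rcases hx with hx | ⟨c, rfl⟩
    · exact ho.smul_left hx
    · exact ho.letter_left c
  | inv_mul_cancel x hx y hy ih =>
    obtain ⟨o, ho⟩ := ih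
    rcases hx with hx | ⟨c, rfl⟩
    · exact ho.smul_left (inv_mem hx)
    · rw [← P.t_inv]
      exact ho.letter_left _

theorem C_disj {δ δ' : Γ} (hδ : δ ∈ Δ) (hδ' : δ' ∈ Δ) {c c' : I} {v : V}
    (hv : v ∈ δ • P.C c) (hv' : v ∈ δ' • P.C c') : δ = δ' ∧ c = c' := by
  have := P.disj (δ'⁻¹ * δ) (mul_mem (inv_mem hδ') hδ) c c' (by
    rw [Set.not_disjoint_iff]
    refine ⟨δ'⁻¹ • v, ?_, Set.mem_smul_set_iff_inv_smul_mem.1 hv'⟩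
    rw [mul_smul]
    exact Set.smul_mem_smul_set hv)
  exact ⟨(inv_mul_eq_one.1 this.1).symm, this.2⟩

variable {P} in
theorem Reduced.smul_mem {h : Γ} {o : Option (Γ × I)} (hh : P.Reduced h o) {v : V}
    (hv : v ∈ P.domain) : (o = none → h ∈ Δ) ∧
      ∀ δ c, o = some (δ, c) → δ ∈ Δ ∧ h • v ∈ δ • P.C c := by
  induction hh with
  | base δ hδ => simpa using hδ
  | cons δ hδ c h o hh ho ih =>
    refine ⟨by simp, ?_⟩
    rintro _ _ ⟨⟩
    refine ⟨hδ, ?_⟩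
    rw [mul_smul, mul_smul]
    refine Set.smul_mem_smul_set ?_
    rw [← P.smul_compl c]
    refine Set.smul_mem_smul_set fun hmem => ?_
    have hmem1 : h • v ∈ (1 : Γ) • P.C (P.inv c) := by rwa [one_smul]
    rcases o with _ | ⟨δ', c'⟩
    · refine hv h⁻¹ (inv_mem (ih.1 rfl)) (P.inv c) ?_
      rwa [Set.mem_smul_set_iff_inv_smul_mem, _root_.inv_inv]
    · obtain ⟨hδ', h'⟩ := ih.2 _ _ rfl
      obtain ⟨rfl, rfl⟩ := P.C_disj hδ' (one_mem _) h' hmem1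
      exact ho rfl

/-- Tiles `h • domain` for distinct cosets `h Δ` are disjoint: this is the ping-pong argument. -/
theorem mem_of_smul_mem_domain {h : Γ} (hh : h ∈ P.group) {v : V} (hv : v ∈ P.domain)
    (hhv : h • v ∈ P.domain) : h ∈ Δ := by
  obtain ⟨o, ho⟩ := P.exists_reduced hh
  obtain ⟨h1, h2⟩ := ho.smul_mem hv
  rcases o with _ | ⟨δ, c⟩
  · exact h1 rfl
  · obtain ⟨hδ, hm⟩ := h2 _ _ rfl
    exact absurd hm (hhv δ hδ c)

theorem Z_subset_domain : P.Z ⊆ P.domain := fun _ hv δ hδ c hm =>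
  Set.disjoint_left.1 (P.Z_disj δ hδ c) hv hm

theorem disjoint_inv (c : I) : Disjoint (P.C c) (P.C (P.inv c)) := by
  by_contra h
  have := P.disj 1 (one_mem _) c (P.inv c) (by simpa using h)
  exact P.inv_ne c this.2.symm

/-- Every half-space contains a half-space which lies in a single tile. -/
theorem exists_subset_tile (h𝓗 : HalfSpaceFamily Γ 𝓗) {M : Set V} (hM : M ∈ 𝓗) :
    ∃ h ∈ P.group, ∃ K ∈ 𝓗, K ⊆ M ∧ K ⊆ h • P.domain := by
  by_cases hex : ∃ h ∈ P.group, ∃ c, h • P.C c ⊆ M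
  · -- `h • C c` contains the adjacent tile `(h * t c) • domain`
    obtain ⟨h, hh, c, hc⟩ := hex
    refine ⟨h * P.t c, mul_mem hh (P.t_mem c), (h * P.t c) • P.Z, h𝓗.smul_mem _ _ P.Z_mem, ?_,
      Set.smul_set_mono P.Z_subset_domain⟩
    refine Set.Subset.trans ?_ hc
    rw [mul_smul, ← P.smul_compl c]
    refine Set.smul_set_mono (Set.smul_set_mono fun v hv hm => ?_)
    exact Set.disjoint_left.1 (P.Z_disj 1 (one_mem _) (P.inv c)) hv (by simpa using hm)
  push Not at hex
  obtain ⟨d, hd⟩ := h𝓗.gate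
  obtain ⟨m, hm⟩ := h𝓗.nonempty M hM
  obtain ⟨z, hz⟩ := h𝓗.nonempty P.Z P.Z_mem
  -- choose the tile closest to a fixed point `m` of `M`
  have hne : ∃ n, ∃ h ∈ P.group, ∃ v ∈ P.domain, d (h • v) m = n :=
    ⟨_, 1, one_mem _, z, P.Z_subset_domain hz, rfl⟩
  classical
  obtain ⟨h, hh, v, hv, hdv⟩ := Nat.find_spec hne
  refine ⟨h, hh, M, hM, subset_rfl, ?_⟩
  intro x hx
  rw [Set.mem_smul_set_iff_inv_smul_mem]
  intro δ hδ c hxc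
  have hxc' : x ∈ (h * δ) • P.C c := by
    rw [mul_smul]
    rwa [Set.mem_smul_set_iff_inv_smul_mem]
  have hhδ : h * δ ∈ P.group := mul_mem hh (P.le_group hδ)
  have hW : (h * δ) • P.C c ∈ 𝓗 := h𝓗.smul_mem _ _ (P.C_mem c)
  have hMW : M ⊆ (h * δ) • P.C c := by
    rcases h𝓗.nested M hM _ hW with h1 | h1 | h1 | h1
    · exact h1
    · exact absurd h1 (hex _ hhδ c)
    · exact absurd hxc' (Set.disjoint_left.1 h1 hx)
    · -- the complement of `C c` contains `C (inv c)`
      refine absurd ?_ (hex _ hhδ (P.inv c))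
      intro y hy
      by_contra hyM
      exact Set.disjoint_left.1 (Set.disjoint_smul_set.2 (P.disjoint_inv c)) (h1 hyM) hy
  obtain ⟨w, hwW, hwd, hwK⟩ := hd _ hW
  have hvW : h • v ∉ (h * δ) • P.C c := by
    rw [mul_smul, Set.smul_mem_smul_set_iff]
    exact hv δ hδ c
  have hlt := hwd _ hvW m (hMW hm)
  -- the entry point `w` of the half-space lies in the adjacent tile, which is then closer to `m`
  have hwdom : (h * δ * P.t c)⁻¹ • w ∈ P.domain := by
    intro δ' hδ' c' hmem
    rw [← Set.mem_smul_set_iff_inv_smul_mem, ← mul_smul] at hmem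
    have hCc : (h * δ) • P.C c = (h * δ * P.t c) • (P.C (P.inv c))ᶜ := by
      rw [mul_smul (h * δ), P.smul_compl]
    have hne' : ¬ (δ' = 1 ∧ c' = P.inv c) := by
      rintro ⟨rfl, rfl⟩
      rw [hCc] at hwW
      simp only [mul_one, Set.smul_set_compl] at hwW hmem
      exact hwW hmem
    have hsub : δ' • P.C c' ⊆ (P.C (P.inv c))ᶜ := by
      rw [Set.subset_compl_iff_disjoint_right]
      by_contra hnd
      exact hne' (P.disj δ' hδ' c' _ hnd)
    have heq := hwK _ (h𝓗.smul_mem (h * δ * P.t c * δ') _ (P.C_mem c'))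
      (by rw [hCc, mul_smul (h * δ * P.t c)]; exact Set.smul_set_mono hsub) hmem
    rw [hCc, mul_smul (h * δ * P.t c), smul_left_cancel_iff] at heq
    -- then the half-spaces `δ' • C c'` and `C (inv c)` cover everything, but both miss `z`
    have hz1 : z ∈ (P.C (P.inv c))ᶜ := fun hmz =>
      Set.disjoint_left.1 (P.Z_disj 1 (one_mem _) (P.inv c)) hz (by simpa using hmz)
    rw [← heq] at hz1
    exact Set.disjoint_left.1 (P.Z_disj δ' hδ' c') hz hz1
  have hmin := Nat.find_min' hne ⟨h * δ * P.t c, mul_mem hhδ (P.t_mem c), _, hwdom, rfl⟩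
  rw [smul_inv_smul] at hmin
  omega

/-- Thinness passes from `Δ` to the group generated by `Δ` and the ping-pong letters: after shrinking
a half-space so that each of its translates by `x⁻¹`, `x ∈ X`, lies in a tile, only elements of `Δ`
can fail to displace it. -/
theorem thin_group (h𝓗 : HalfSpaceFamily Γ 𝓗) (hΔ : Thin 𝓗 Δ) : Thin 𝓗 P.group := by
  intro X hX H hH
  have key : ∃ K ∈ 𝓗, K ⊆ H ∧ ∀ x ∈ X, ∃ h ∈ P.group, x⁻¹ • K ⊆ h • P.domain := by
    clear hΔ
    induction X, hX using Set.Finite.induction_on with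
    | empty => exact ⟨H, hH, subset_rfl, by simp⟩
    | @insert a S _ _ ih =>
      obtain ⟨K, hK, hKH, hKS⟩ := ih
      obtain ⟨h, hh, L, hL, hLK, hLd⟩ := P.exists_subset_tile h𝓗 (h𝓗.smul_mem a⁻¹ K hK)
      have haL : a • L ⊆ K := by
        rwa [Set.subset_smul_set_iff, _root_.inv_inv] at hLK
      refine ⟨a • L, h𝓗.smul_mem _ _ hL, haL.trans hKH, ?_⟩
      rintro x (rfl | hx)
      · exact ⟨h, hh, by simpa using hLd⟩
      · obtain ⟨h', hh', hs⟩ := hKS x hx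
        exact ⟨h', hh', (Set.smul_set_mono haL).trans hs⟩
  obtain ⟨K, hK, hKH, hKX⟩ := key
  choose! f hf hfK using hKX
  obtain ⟨L, hL, hLK, hd⟩ := hΔ ((fun x => x * f x) '' X) (hX.image _) K hK
  refine ⟨L, hL, hLK.trans hKH, fun x hx y hy δ hδ h1 => ?_⟩
  by_contra hnd
  obtain ⟨v, hv, hvL⟩ := Set.not_disjoint_iff.1 hnd
  rw [Set.mem_smul_set_iff_inv_smul_mem] at hv
  have hx' : (x * f x)⁻¹ • v ∈ P.domain := by
    have := hfK x hx (Set.smul_mem_smul_set (hLK hvL))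
    rwa [Set.mem_smul_set_iff_inv_smul_mem, ← mul_smul, ← mul_inv_rev] at this
  have hy' : (y * f y)⁻¹ • (x * δ * y⁻¹)⁻¹ • v ∈ P.domain := by
    have := hfK y hy (Set.smul_mem_smul_set (hLK hv))
    rwa [Set.mem_smul_set_iff_inv_smul_mem, ← mul_smul (f y)⁻¹, ← mul_inv_rev] at this
  have hmem : (f x)⁻¹ * δ * f y ∈ Δ := by
    refine P.mem_of_smul_mem_domain
      (mul_mem (mul_mem (inv_mem (hf x hx)) hδ) (hf y hy)) hy' ?_
    convert hx' using 1
    simp only [smul_smul]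
    congr 1
    group
  have heq : x * f x * ((f x)⁻¹ * δ * f y) * (y * f y)⁻¹ = x * δ * y⁻¹ := by group
  have := hd _ ⟨x, hx, rfl⟩ _ ⟨y, hy, rfl⟩ _ hmem (by rwa [heq])
  rw [heq] at this
  exact hnd this

/-- An element outside `Δ` which maps `Z` into the domain stays outside the larger group. -/
theorem notMem_group {s : Γ} (hs : s ∉ Δ) (hZ : s • P.Z ⊆ P.domain) (hne : P.Z.Nonempty) :
    s ∉ P.group := by
  intro hmem
  obtain ⟨z, hz⟩ := hne
  exact hs (P.mem_of_smul_mem_domain hmem (P.Z_subset_domain hz)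
    (hZ (Set.smul_mem_smul_set hz)))

end PingPong

end PingPong

/-! ### Extending thin subgroups -/

section Extension

variable {Γ V : Type*} [Group Γ] [MulAction Γ V] {𝓗 : Set (Set V)}

/-- Given two `k`-tuples of distinct cosets of a thin subgroup `Δ`, some thin subgroup containing `Δ`
and avoiding a given finite subset of `Γ \ Δ` contains all `(y i)⁻¹ * g * x i`, for a suitable `g`.
Take a half-space `K` that is small with respect to the tuples, and `K₁`, `K₂` disjoint in `K`, with
`g` mapping the complement of `K₁` onto `K₂`; then `(y i)⁻¹ * g * x i` plays ping-pong with the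
half-spaces `(x i)⁻¹ • K₁` and `(y i)⁻¹ • K₂`. -/
theorem Thin.exists_extension (h𝓗 : HalfSpaceFamily Γ 𝓗) {Δ : Subgroup Γ} (hΔ : Thin 𝓗 Δ)
    {S : Set Γ} (hS : S.Finite) (hSΔ : ∀ s ∈ S, s ∉ Δ) {k : ℕ} (x y : Fin k → Γ)
    (hx : ∀ i j, (x i)⁻¹ * x j ∈ Δ → i = j) (hy : ∀ i j, (y i)⁻¹ * y j ∈ Δ → i = j) :
    ∃ Δ' : Subgroup Γ, Δ ≤ Δ' ∧ Thin 𝓗 Δ' ∧ (∀ s ∈ S, s ∉ Δ') ∧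
      ∃ g : Γ, ∀ i, (y i)⁻¹ * g * x i ∈ Δ' := by
  let w : Fin k × Bool → Γ := fun c => if c.2 then y c.1 else x c.1
  have hw : ∀ i j b, (w (i, b))⁻¹ * w (j, b) ∈ Δ → i = j := by
    rintro i j (_ | _)
    · exact hx i j
    · exact hy i j
  obtain ⟨-, -, H, hH, -⟩ := h𝓗.shift
  -- `X` contains `1` and `S⁻¹` so that `Z` and its translates by `S` avoid the ping-pong sets
  obtain ⟨K, hK, -, hd⟩ := hΔ (Set.range w ∪ insert 1 S⁻¹)
    ((Set.finite_range w).union (hS.inv.insert 1)) H hH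
  obtain ⟨A, hA, Z, hZ, hAK, hZK, hAZ⟩ := h𝓗.exists_disjoint_pair hK
  obtain ⟨A₁, hA₁, A₂, hA₂, hA₁A, hA₂A, hA₁₂⟩ := h𝓗.exists_disjoint_pair hA
  obtain ⟨μ, hμ⟩ := h𝓗.proximal' hH hA₁
  obtain ⟨ν, hν⟩ := h𝓗.proximal H hH A₂ hA₂
  let L : Bool → Set V := fun b => if b then ν • Hᶜ else μ • H
  let γ : Bool → Γ := fun b => if b then ν * μ⁻¹ else μ * ν⁻¹
  have hL : ∀ b, L b ∈ 𝓗 := by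
    rintro (_ | _)
    · exact h𝓗.smul_mem _ _ hH
    · exact h𝓗.smul_mem _ _ (h𝓗.compl_mem _ hH)
  have hLA : ∀ b, L b ⊆ A := by
    rintro (_ | _)
    · exact hμ.trans hA₁A
    · exact hν.trans hA₂A
  have hγinv : ∀ b, γ (!b) = (γ b)⁻¹ := by
    rintro (_ | _) <;> simp [γ]
  have hγ : ∀ b, γ b • (L (!b))ᶜ = L b := by
    rintro (_ | _) <;> simp [γ, L, mul_smul, Set.smul_set_compl]
  have hLdisj : ∀ b b', ¬ Disjoint (L b) (L b') → b = b' := by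
    rintro (_ | _) (_ | _) h
    · rfl
    · exact absurd (hA₁₂.mono hμ hν) h
    · exact absurd (hA₁₂.symm.mono hν hμ) h
    · rfl
  -- points of `Z` and of its translates by `S` lie outside the ping-pong sets
  have hZout : ∀ s, s⁻¹ ∈ insert 1 S⁻¹ → ∀ δ ∈ Δ, ∀ c : Fin k × Bool, ∀ v ∈ Z,
      s • v ∉ δ • (w c)⁻¹ • L c.2 := by
    intro s hs δ hδ c v hv hm
    rw [Set.mem_smul_set_iff_inv_smul_mem, Set.mem_smul_set_iff_inv_smul_mem, _root_.inv_inv,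
      smul_smul, smul_smul] at hm
    have hm' : (w c * δ⁻¹ * (s⁻¹)⁻¹) • v ∈ L c.2 := by
      rwa [_root_.inv_inv]
    by_cases h1 : w c * δ⁻¹ * (s⁻¹)⁻¹ = 1
    · rw [h1, one_smul] at hm'
      exact Set.disjoint_left.1 hAZ (hLA _ hm') hv
    · exact Set.disjoint_left.1 (hd _ (Or.inl ⟨c, rfl⟩) _ (Or.inr hs) _ (inv_mem hδ) h1)
        (Set.smul_mem_smul_set (hZK hv)) (hAK (hLA _ hm'))
  let P : PingPong 𝓗 Δ (Fin k × Bool) :=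
    { inv := fun c => (c.1, !c.2)
      t := fun c => (w c)⁻¹ * γ c.2 * w (c.1, !c.2)
      C := fun c => (w c)⁻¹ • L c.2
      Z := Z
      inv_ne := fun c h => by simpa using congrArg Prod.snd h
      inv_inv := fun c => by simp
      t_inv := fun c => by simp [hγinv, mul_assoc]
      smul_compl := fun c => by
        rw [← Set.smul_set_compl, mul_smul, smul_inv_smul, mul_smul, hγ]
      C_mem := fun c => h𝓗.smul_mem _ _ (hL _)
      Z_mem := hZ
      disj := by
        rintro δ hδ ⟨i, b⟩ ⟨j, b'⟩ h
        obtain ⟨v, hv, hv'⟩ := Set.not_disjoint_iff.1 h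
        have hs : ∃ u ∈ L b, (w (j, b') * δ * (w (i, b))⁻¹) • u ∈ L b' := by
          rw [Set.mem_smul_set_iff_inv_smul_mem] at hv hv'
          obtain ⟨u, hu, huv⟩ := hv
          refine ⟨u, hu, ?_⟩
          have hveq : v = δ • (w (i, b))⁻¹ • u := by
            rw [← smul_inv_smul δ v, ← huv]
          rw [hveq, _root_.inv_inv] at hv'
          simpa [mul_smul] using hv'
        obtain ⟨u, hu, hu'⟩ := hs
        by_cases h1 : w (j, b') * δ * (w (i, b))⁻¹ = 1
        · rw [h1, one_smul] at hu'
          obtain rfl := hLdisj b b' (Set.not_disjoint_iff.2 ⟨u, hu, hu'⟩)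
          have hδeq : δ = (w (j, b))⁻¹ * w (i, b) := by
            rw [mul_inv_eq_one] at h1
            rw [← h1, inv_mul_cancel_left]
          obtain rfl := hw j i b (hδeq ▸ hδ)
          exact ⟨by simpa using hδeq, rfl⟩
        · exact (Set.disjoint_left.1 (hd _ (Or.inl ⟨_, rfl⟩) _ (Or.inl ⟨_, rfl⟩) δ hδ h1)
            (Set.smul_mem_smul_set (hAK (hLA _ hu))) (hAK (hLA _ hu'))).elim
      Z_disj := fun δ hδ c => Set.disjoint_left.2 fun v hv hm =>
        hZout 1 (by simp) δ hδ c v hv (by simpa using hm) }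
  refine ⟨P.group, P.le_group, P.thin_group h𝓗 hΔ, fun s hs => ?_, ν * μ⁻¹, fun i => ?_⟩
  · refine P.notMem_group (hSΔ s hs) ?_ (h𝓗.nonempty _ hZ)
    rintro _ ⟨v, hv, rfl⟩ δ hδ c
    exact hZout s (Or.inr (by simpa using hs)) δ hδ c v hv
  · exact P.t_mem (i, true)

/-- Given finitely many non-trivial elements `f` and finitely many cosets of a thin subgroup `Δ`,
some coset `z Δ` is different from the given ones and moved by each `f`. The element `z` is chosen
to map the complement of a half-space `K` which `Δ` displaces into a half-space which is displaced
by each `f` and too small to contain the relevant translates of `K` and of its complement. -/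
theorem Thin.exists_moved_coset (h𝓗 : HalfSpaceFamily Γ 𝓗) {Δ : Subgroup Γ} (hΔ : Thin 𝓗 Δ)
    {F E : Set Γ} (hF : F.Finite) (hF1 : (1 : Γ) ∉ F) (hE : E.Finite) :
    ∃ z : Γ, (∀ f ∈ F, z⁻¹ * f * z ∉ Δ) ∧ ∀ e ∈ E, e⁻¹ * z ∉ Δ := by
  obtain ⟨-, -, H, hH, -⟩ := h𝓗.shift
  obtain ⟨K, hK, -, hdΔ⟩ := hΔ {1} (Set.finite_singleton 1) H hH
  have hdK : ∀ δ ∈ Δ, δ ≠ 1 → Disjoint (δ • K) K := by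
    intro δ hδ h1
    simpa using hdΔ 1 rfl 1 rfl δ hδ (by simpa using h1)
  obtain ⟨L₁, hL₁, -, hdF⟩ := h𝓗.exists_displaced F hF hH
  obtain ⟨L₂, hL₂, hL₂₁, hnot⟩ := h𝓗.exists_not_superset
    ((fun e : Γ => e • K) '' E ∪ (fun e : Γ => e • Kᶜ) '' E) ((hE.image _).union (hE.image _))
    (by
      rintro _ (⟨e, -, rfl⟩ | ⟨e, -, rfl⟩)
      · exact (h𝓗.nonempty _ hK).smul_set
      · exact (h𝓗.nonempty _ (h𝓗.compl_mem _ hK)).smul_set) hL₁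
  obtain ⟨A, hA, B, hB, hAL, hBL, hAB⟩ := h𝓗.exists_disjoint_pair hL₂
  obtain ⟨z, hz⟩ := h𝓗.proximal K hK A hA
  refine ⟨z, fun f hf hmem => ?_, fun e he hmem => ?_⟩
  · have hf1 : f ≠ 1 := fun h => hF1 (h ▸ hf)
    have hδ1 : z⁻¹ * f * z ≠ 1 := by
      intro h
      apply hf1
      have : f = z * (z⁻¹ * f * z) * z⁻¹ := by group
      rw [this, h]
      simp
    have hδ := hdK _ hmem hδ1
    obtain ⟨b, hb⟩ := h𝓗.nonempty B hB
    have hbz : z⁻¹ • b ∈ K := by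
      by_contra hn
      have : b ∈ z • Kᶜ := Set.mem_smul_set_iff_inv_smul_mem.2 hn
      exact Set.disjoint_left.1 hAB (hz this) hb
    have hfb : f • b ∈ A := by
      have h1 : (z⁻¹ * f * z) • z⁻¹ • b ∉ K := Set.disjoint_left.1 hδ (Set.smul_mem_smul_set hbz)
      have h2 := hz (Set.smul_mem_smul_set (a := z) (show _ ∈ Kᶜ from h1))
      simpa [smul_smul, mul_assoc] using h2
    exact Set.disjoint_left.1 (hdF f hf hf1) (Set.smul_mem_smul_set (hL₂₁ (hBL hb)))
      (hL₂₁ (hAL hfb))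
  · by_cases h1 : e⁻¹ * z = 1
    · obtain rfl := inv_mul_eq_one.1 h1
      exact hnot _ (Or.inr ⟨e, he, rfl⟩) (hz.trans hAL)
    · have hδ := hdK _ hmem h1
      refine hnot _ (Or.inl ⟨e, he, rfl⟩) (Set.Subset.trans ?_ (hz.trans hAL))
      have h2 : K ⊆ (e⁻¹ * z) • Kᶜ := by
        rw [Set.smul_set_compl, Set.subset_compl_iff_disjoint_left]
        exact hδ
      calc e • K ⊆ e • (e⁻¹ * z) • Kᶜ := Set.smul_set_mono h2
        _ = z • Kᶜ := by rw [smul_smul, mul_inv_cancel_left]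

end Extension

/-! ### The generic subgroup -/

section Generic

variable {Γ V : Type*} [Group Γ] [MulAction Γ V] {𝓗 : Set (Set V)}

/-- A finite approximation of the generic subgroup: a thin subgroup, which the generic subgroup is
to contain, and a finite set, which it is to avoid. -/
structure Condition (Γ : Type*) {V : Type*} [Group Γ] [MulAction Γ V] (𝓗 : Set (Set V)) where
  /-- the thin subgroup -/
  group : Subgroup Γ
  /-- the set of elements to be avoided -/
  avoid : Set Γ
  thin : Thin 𝓗 group
  finite : avoid.Finite
  notMem : ∀ s ∈ avoid, s ∉ group

instance : Preorder (Condition Γ 𝓗) := Preorder.lift fun p => (p.group, p.avoid)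

/-- The conditions deciding that the cosets of the `x i`, or those of the `y i`, are not distinct,
or that some group element maps the cosets of the `x i` to those of the `y i`. -/
def transitivityConditions (h𝓗 : HalfSpaceFamily Γ 𝓗) {k : ℕ} (x y : Fin k → Γ) :
    Order.Cofinal (Condition Γ 𝓗) where
  carrier := {p | (∀ i j, (x i)⁻¹ * x j ∈ p.group → i = j) →
    (∀ i j, (y i)⁻¹ * y j ∈ p.group → i = j) → ∃ g : Γ, ∀ i, (y i)⁻¹ * g * x i ∈ p.group}
  isCofinal p := by
    by_cases hx : ∀ i j, (x i)⁻¹ * x j ∈ p.group → i = j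
    · by_cases hy : ∀ i j, (y i)⁻¹ * y j ∈ p.group → i = j
      · obtain ⟨Δ, hle, hthin, hS, hg⟩ := p.thin.exists_extension h𝓗 p.finite p.notMem x y hx hy
        exact ⟨⟨Δ, p.avoid, hthin, p.finite, hS⟩, fun _ _ => hg, hle, le_rfl⟩
      · exact ⟨p, fun _ h => absurd h hy, le_rfl⟩
    · exact ⟨p, fun h => absurd h hx, le_rfl⟩

/-- The conditions ensuring that some coset different from those of the elements of `E` is moved by
all elements of `F`. -/
def faithfulnessConditions (h𝓗 : HalfSpaceFamily Γ 𝓗) (F E : Finset Γ) :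
    Order.Cofinal (Condition Γ 𝓗) where
  carrier := {p | (1 : Γ) ∉ F →
    ∃ z : Γ, (∀ f ∈ F, z⁻¹ * f * z ∈ p.avoid) ∧ ∀ e ∈ E, e⁻¹ * z ∈ p.avoid}
  isCofinal p := by
    by_cases h1 : (1 : Γ) ∈ F
    · exact ⟨p, fun h => absurd h1 h, le_rfl⟩
    · obtain ⟨z, hF, hE⟩ := p.thin.exists_moved_coset h𝓗 (F := F) (E := E) F.finite_toSet
        (by simpa using h1) E.finite_toSet
      refine ⟨⟨p.group, p.avoid ∪ ((fun f => z⁻¹ * f * z) '' F ∪ (fun e => e⁻¹ * z) '' E),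
        p.thin, p.finite.union ((F.finite_toSet.image _).union (E.finite_toSet.image _)), ?_⟩,
        fun _ => ⟨z, fun f hf => Or.inr (Or.inl ⟨f, hf, rfl⟩),
          fun e he => Or.inr (Or.inr ⟨e, he, rfl⟩)⟩, le_rfl, Set.subset_union_left⟩
      rintro s (hs | ⟨f, hf, rfl⟩ | ⟨e, he, rfl⟩)
      · exact p.notMem s hs
      · exact hF f hf
      · exact hE e he

/-- The generic subgroup is the union of the thin subgroups of a sequence of conditions that meets
the countably many cofinal sets of conditions above. -/
theorem HalfSpaceFamily.exists_generic_subgroup [Countable Γ] (h𝓗 : HalfSpaceFamily Γ 𝓗) :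
    ∃ Δ : Subgroup Γ,
      (∀ (k : ℕ) (x y : Fin k → Γ), (∀ i j, (x i)⁻¹ * x j ∈ Δ → i = j) →
        (∀ i j, (y i)⁻¹ * y j ∈ Δ → i = j) → ∃ g : Γ, ∀ i, (y i)⁻¹ * g * x i ∈ Δ) ∧
      ∀ F E : Finset Γ, (1 : Γ) ∉ F →
        ∃ z : Γ, (∀ f ∈ F, z⁻¹ * f * z ∉ Δ) ∧ ∀ e ∈ E, e⁻¹ * z ∉ Δ := by
  let ι := (Σ k : ℕ, (Fin k → Γ) × (Fin k → Γ)) ⊕ (Finset Γ × Finset Γ)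
  let _ : Encodable ι := Encodable.ofCountable ι
  let 𝒟 : ι → Order.Cofinal (Condition Γ 𝓗) := Sum.elim
    (fun a => transitivityConditions h𝓗 a.2.1 a.2.2) (fun a => faithfulnessConditions h𝓗 a.1 a.2)
  let p₀ : Condition Γ 𝓗 := ⟨⊥, ∅, h𝓗.thin_bot, Set.finite_empty, by simp⟩
  let p : ℕ → Condition Γ 𝓗 := Order.sequenceOfCofinals p₀ 𝒟
  have hp : Monotone p := Order.sequenceOfCofinals.monotone p₀ 𝒟
  have hmono : Monotone fun n => (p n).group := fun m n h => (hp h).1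
  have hmem : ∀ {s : Γ}, s ∈ ⨆ n, (p n).group ↔ ∃ n, s ∈ (p n).group :=
    Subgroup.mem_iSup_of_directed hmono.directed_le
  have hav : ∀ n, ∀ s ∈ (p n).avoid, s ∉ ⨆ n, (p n).group := by
    intro n s hs hmem'
    obtain ⟨m, hm⟩ := hmem.1 hmem'
    exact (p (max n m)).notMem s ((hp (le_max_left n m)).2 hs) ((hp (le_max_right n m)).1 hm)
  refine ⟨⨆ n, (p n).group, fun k x y hx hy => ?_, fun F E hF => ?_⟩
  · have h := Order.sequenceOfCofinals.encode_mem p₀ 𝒟 (Sum.inl ⟨k, x, y⟩)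
    obtain ⟨g, hg⟩ := h (fun i j hij => hx i j (hmem.2 ⟨_, hij⟩))
      (fun i j hij => hy i j (hmem.2 ⟨_, hij⟩))
    exact ⟨g, fun i => hmem.2 ⟨_, hg i⟩⟩
  · have h := Order.sequenceOfCofinals.encode_mem p₀ 𝒟 (Sum.inr ⟨F, E⟩)
    obtain ⟨z, hzF, hzE⟩ := h hF
    exact ⟨z, fun f hf => hav _ _ (hzF f hf), fun e he => hav _ _ (hzE e he)⟩

/-- The action on the cosets of the generic subgroup, transported to `ℕ` so as to live in `Type`. -/
theorem HalfSpaceFamily.exists_action [Countable Γ] (h𝓗 : HalfSpaceFamily Γ 𝓗) :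
    ∃ (X : Type) (_ : Countable X) (_ : Infinite X) (_ : MulAction Γ X),
      IsHighlyTransitive Γ X ∧ IsHighlyFaithful Γ X := by
  obtain ⟨Δ, hT, hF⟩ := h𝓗.exists_generic_subgroup
  -- finitely many cosets are avoided through finitely many representatives
  have hF' : ∀ F : Finset Γ, (1 : Γ) ∉ F → {x : Γ ⧸ Δ | ∀ g ∈ F, g • x ≠ x}.Infinite := by
    classical
    intro F h1 hfin
    obtain ⟨z, hz, hzE⟩ := hF F (hfin.toFinset.image Quotient.out) h1
    have hzmem : (z : Γ ⧸ Δ) ∈ {x : Γ ⧸ Δ | ∀ g ∈ F, g • x ≠ x} := by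
      intro g hg h
      rw [MulAction.Quotient.smul_coe, smul_eq_mul, eq_comm, QuotientGroup.eq, ← mul_assoc] at h
      exact hz g hg h
    refine hzE _ (Finset.mem_image_of_mem _ (hfin.mem_toFinset.2 hzmem)) ?_
    rw [← QuotientGroup.eq, QuotientGroup.out_eq']
  have hinf : Infinite (Γ ⧸ Δ) := by
    have := hF' ∅ (by simp)
    simpa [Set.infinite_univ_iff] using this
  have hcount : Countable (Γ ⧸ Δ) := Quotient.countable
  obtain ⟨e⟩ : Nonempty (ℕ ≃ Γ ⧸ Δ) := by
    obtain ⟨_⟩ := nonempty_denumerable (Γ ⧸ Δ)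
    exact ⟨(Denumerable.eqv _).symm⟩
  let _ : MulAction Γ ℕ := e.mulAction Γ
  have he : ∀ (g : Γ) (n : ℕ), e (g • n) = g • e n := fun g n => e.apply_symm_apply _
  refine ⟨ℕ, inferInstance, inferInstance, inferInstance, ?_, ?_⟩
  · intro k x y hx hy
    have hinj : ∀ u : Fin k → ℕ, Function.Injective u →
        ∀ i j, ((e (u i)).out)⁻¹ * (e (u j)).out ∈ Δ → i = j := by
      intro u hu i j h
      rw [← QuotientGroup.eq, QuotientGroup.out_eq', QuotientGroup.out_eq'] at h
      exact hu (e.injective h)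
    obtain ⟨g, hg⟩ := hT k _ _ (hinj x hx) (hinj y hy)
    refine ⟨g, fun i => e.injective ?_⟩
    have := hg i
    rw [mul_assoc, ← QuotientGroup.eq, QuotientGroup.out_eq'] at this
    rw [he, this, ← smul_eq_mul, ← MulAction.Quotient.smul_coe, QuotientGroup.out_eq']
  · intro F h1
    have := hF' F h1
    rw [← Set.infinite_image_iff e.symm.injective.injOn] at this
    refine this.mono ?_
    rintro _ ⟨q, hq, rfl⟩ g hg h
    apply hq g hg
    have h2 := congrArg e h
    rwa [he, e.apply_symm_apply] at h2

end Generic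

/-! ### Half-trees -/

section Sides

variable {V : Type*} {T : SimpleGraph V}

/-- The component of `v` in the graph obtained by removing the edge between `u` and `v`. If `T` is a
tree and `u`, `v` are adjacent, this is the half-tree of the oriented edge from `u` to `v`, without
the vertex `u`. With this convention `side T u v` and `side T v u` are complementary. -/
def side (T : SimpleGraph V) (u v : V) : Set V := {w | (T.deleteEdges {s(u, v)}).Reachable v w}

theorem right_mem_side (u v : V) : v ∈ side T u v := SimpleGraph.Reachable.refl _

/-- The only edge leaving a side is the one defining it. -/
theorem eq_of_adj_of_mem_side {u v x y : V} (hxy : T.Adj x y) (hx : x ∈ side T u v)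
    (hy : y ∉ side T u v) : s(x, y) = s(u, v) := by
  by_contra hne
  refine hy (SimpleGraph.Reachable.trans hx (SimpleGraph.Adj.reachable ?_))
  rw [SimpleGraph.deleteEdges_adj]
  exact ⟨hxy, hne⟩

/-- Sides are connected: a property of the vertex `v` which is inherited by neighbours inside the
side holds throughout `side T u v`. -/
theorem side_induction {u v : V} {P : V → Prop} (hv : P v)
    (hstep : ∀ x ∈ side T u v, ∀ y ∈ side T u v, T.Adj x y → P x → P y) :
    ∀ w ∈ side T u v, P w := by
  intro w hw
  have hw' : (T.deleteEdges {s(u, v)}).Reachable v w := hw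
  rw [SimpleGraph.reachable_iff_reflTransGen] at hw'
  induction hw' with
  | refl => exact hv
  | @tail b c hb hbc ih =>
    have hb' : b ∈ side T u v := (SimpleGraph.reachable_iff_reflTransGen _ _).2 hb
    exact hstep b hb' c hw (SimpleGraph.deleteEdges_adj.1 hbc).1 (ih hb')

theorem left_notMem_side (hT : T.IsTree) {u v : V} (huv : T.Adj u v) : u ∉ side T u v := by
  intro h
  have := SimpleGraph.isAcyclic_iff_forall_adj_isBridge.1 hT.isAcyclic huv
  rw [SimpleGraph.isBridge_iff] at this
  exact this h.symm

theorem disjoint_side (hT : T.IsTree) {u v : V} (huv : T.Adj u v) :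
    Disjoint (side T u v) (side T v u) := by
  rw [Set.disjoint_left]
  intro w hw hw'
  have hw2 : (T.deleteEdges {s(u, v)}).Reachable u w := by
    have : (T.deleteEdges {s(v, u)}).Reachable u w := hw'
    rwa [Sym2.eq_swap] at this
  exact left_notMem_side hT huv (SimpleGraph.Reachable.trans hw hw2.symm)

/-- A connected graph is covered by the two sides of an edge. -/
theorem mem_side_or (hT : T.IsTree) (u v w : V) : w ∈ side T u v ∨ w ∈ side T v u := by
  have hr := (SimpleGraph.reachable_iff_reflTransGen _ _).1 (hT.connected v w)
  induction hr with
  | refl => exact Or.inl (right_mem_side u v)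
  | @tail b c _ hbc ih =>
    by_contra! hc
    rcases ih with ih | ih
    · have := eq_of_adj_of_mem_side hbc ih hc.1
      rcases Sym2.eq_iff.1 this with ⟨-, rfl⟩ | ⟨-, rfl⟩
      · exact hc.1 (right_mem_side _ _)
      · exact hc.2 (right_mem_side _ _)
    · have := eq_of_adj_of_mem_side hbc ih hc.2
      rcases Sym2.eq_iff.1 this with ⟨-, rfl⟩ | ⟨-, rfl⟩
      · exact hc.2 (right_mem_side _ _)
      · exact hc.1 (right_mem_side _ _)

theorem compl_side (hT : T.IsTree) {u v : V} (huv : T.Adj u v) :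
    (side T u v)ᶜ = side T v u := by
  ext w
  refine ⟨fun h => (mem_side_or hT u v w).resolve_left h, fun h h' =>
    Set.disjoint_left.1 (disjoint_side hT huv) h' h⟩

theorem eq_of_adj_of_notMem_side (hT : T.IsTree) {u v x y : V} (hxy : T.Adj x y)
    (huv : T.Adj u v) (hx : x ∉ side T u v) (hy : y ∈ side T u v) : x = u ∧ y = v := by
  rcases Sym2.eq_iff.1 (eq_of_adj_of_mem_side hxy.symm hy hx) with ⟨rfl, rfl⟩ | ⟨rfl, rfl⟩
  · exact absurd hy (left_notMem_side hT huv)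
  · exact ⟨rfl, rfl⟩

/-- A walk entering a side passes through the edge defining it. -/
theorem dist_add_one_add_dist_le (hT : T.IsTree) {u v : V} (huv : T.Adj u v) {x m : V}
    (hx : x ∉ side T u v) (hm : m ∈ side T u v) :
    T.dist x u + 1 + T.dist v m ≤ T.dist x m := by
  obtain ⟨p, hp⟩ := hT.connected.exists_walk_length_eq_dist x m
  rw [← hp]
  clear hp
  induction p with
  | nil => exact absurd hm hx
  | @cons a b c hab p ih =>
    by_cases hb : b ∈ side T u v
    · obtain ⟨rfl, rfl⟩ := eq_of_adj_of_notMem_side hT hab huv hx hb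
      have := SimpleGraph.dist_le p
      simp only [SimpleGraph.dist_self, SimpleGraph.Walk.length_cons]
      omega
    · have h1 := ih hb hm
      have h2 := hT.connected.dist_triangle (u := a) (v := b) (w := u)
      have h3 : T.dist a b = 1 := SimpleGraph.dist_eq_one_iff_adj.2 hab
      simp only [SimpleGraph.Walk.length_cons]
      omega

theorem dist_eq_of_mem_side (hT : T.IsTree) {u v : V} (huv : T.Adj u v) {w : V}
    (hw : w ∈ side T u v) : T.dist u w = T.dist v w + 1 := by
  have h1 := dist_add_one_add_dist_le hT huv (left_notMem_side hT huv) hw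
  have h2 := hT.connected.dist_triangle (u := u) (v := v) (w := w)
  have h3 : T.dist u v = 1 := SimpleGraph.dist_eq_one_iff_adj.2 huv
  simp only [SimpleGraph.dist_self] at h1
  omega

theorem mem_side_iff (hT : T.IsTree) {u v : V} (huv : T.Adj u v) {w : V} :
    w ∈ side T u v ↔ T.dist v w < T.dist u w := by
  refine ⟨fun h => by have := dist_eq_of_mem_side hT huv h; omega, fun h => ?_⟩
  by_contra hn
  have := dist_eq_of_mem_side hT huv.symm ((mem_side_or hT u v w).resolve_left hn)
  omega

/-- Sides are convex. -/
theorem mem_side_of_dist_add (hT : T.IsTree) {u v : V} (huv : T.Adj u v) {x y z : V}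
    (hx : x ∈ side T u v) (hz : z ∈ side T u v) (hy : T.dist x y + T.dist y z = T.dist x z) :
    y ∈ side T u v := by
  by_contra hn
  have h1 := dist_add_one_add_dist_le hT huv hn hx
  have h2 := dist_add_one_add_dist_le hT huv hn hz
  have h3 := hT.connected.dist_triangle (u := x) (v := v) (w := z)
  rw [T.dist_comm (u := x) (v := y)] at hy
  rw [T.dist_comm (u := x) (v := v)] at h3
  omega

/-- Unless both ends of the edge `u'v'` lie in `side T u v`, this side is not cut by that edge. -/
theorem side_subset_or_disjoint (hT : T.IsTree) {u v u' v' : V} (huv' : T.Adj u' v')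
    (h : ¬ (u' ∈ side T u v ∧ v' ∈ side T u v)) :
    side T u v ⊆ side T u' v' ∨ Disjoint (side T u v) (side T u' v') := by
  have hcross : ∀ x ∈ side T u v, ∀ y ∈ side T u v, T.Adj x y →
      (x ∈ side T u' v' ↔ y ∈ side T u' v') := by
    intro x hx y hy hxy
    constructor <;> intro h1 <;> by_contra h2
    · obtain ⟨rfl, rfl⟩ := eq_of_adj_of_notMem_side hT hxy.symm huv' h2 h1
      exact h ⟨hy, hx⟩
    · obtain ⟨rfl, rfl⟩ := eq_of_adj_of_notMem_side hT hxy huv' h2 h1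
      exact h ⟨hx, hy⟩
  by_cases hv : v ∈ side T u' v'
  · exact Or.inl (side_induction hv fun x hx y hy hxy h1 => (hcross x hx y hy hxy).1 h1)
  · exact Or.inr (Set.disjoint_left.2 (side_induction (P := fun w => w ∉ side T u' v') hv
      fun x hx y hy hxy h1 h2 => h1 ((hcross x hx y hy hxy).2 h2)))

theorem side_nested (hT : T.IsTree) {u v u' v' : V} (huv : T.Adj u v) (huv' : T.Adj u' v') :
    side T u v ⊆ side T u' v' ∨ side T u' v' ⊆ side T u v ∨
      Disjoint (side T u v) (side T u' v') ∨ (side T u v)ᶜ ⊆ side T u' v' := by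
  by_cases h : u' ∈ side T u v ∧ v' ∈ side T u v
  · have h' : ¬ (u' ∈ side T v u ∧ v' ∈ side T v u) := fun h2 =>
      Set.disjoint_left.1 (disjoint_side hT huv) h.1 h2.1
    rcases side_subset_or_disjoint hT huv' h' with h1 | h1
    · exact Or.inr (Or.inr (Or.inr (by rwa [compl_side hT huv])))
    · refine Or.inr (Or.inl ?_)
      rw [← compl_side hT huv, Set.disjoint_compl_left_iff_subset] at h1
      exact h1
  · rcases side_subset_or_disjoint hT huv' h with h1 | h1
    · exact Or.inl h1
    · exact Or.inr (Or.inr (Or.inl h1))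

end Sides

/-! ### Geodesic rays and half-trees -/

section Rays

variable {V : Type*} {T : SimpleGraph V}

theorem GeodesicRay.adj (ω : GeodesicRay T) (n : ℕ) : T.Adj (ω.toFun n) (ω.toFun (n + 1)) := by
  rw [← SimpleGraph.dist_eq_one_iff_adj]
  have := ω.dist_eq n (n + 1)
  push_cast at this
  simpa using this

/-- The half-tree in which the ray `ω` stays after time `n`. -/
def GeodesicRay.tail (ω : GeodesicRay T) (n : ℕ) : Set V :=
  side T (ω.toFun n) (ω.toFun (n + 1))

theorem GeodesicRay.dist_zero (ω : GeodesicRay T) (n : ℕ) : T.dist (ω.toFun 0) (ω.toFun n) = n := by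
  have := ω.dist_eq 0 n
  simpa using this

theorem GeodesicRay.mem_tail (ω : GeodesicRay T) (hT : T.IsTree) {n m : ℕ} (h : n < m) :
    ω.toFun m ∈ ω.tail n := by
  rw [GeodesicRay.tail, mem_side_iff hT (ω.adj n)]
  have h1 := ω.dist_eq n m
  have h2 := ω.dist_eq (n + 1) m
  rw [abs_of_nonneg (by omega)] at h1
  rw [abs_of_nonneg (by push_cast; omega)] at h2
  push_cast at h2
  omega

theorem GeodesicRay.notMem_tail (ω : GeodesicRay T) (hT : T.IsTree) {n m : ℕ} (h : m ≤ n) :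
    ω.toFun m ∉ ω.tail n := by
  rw [GeodesicRay.tail, mem_side_iff hT (ω.adj n)]
  have h1 := ω.dist_eq n m
  have h2 := ω.dist_eq (n + 1) m
  rw [abs_of_nonpos (by omega)] at h1
  rw [abs_of_nonpos (by push_cast; omega)] at h2
  push_cast at h2
  omega

theorem GeodesicRay.tail_antitone (ω : GeodesicRay T) (hT : T.IsTree) : Antitone ω.tail := by
  refine antitone_nat_of_succ_le fun n => ?_
  have h0 : ω.toFun n ∉ ω.tail (n + 1) := ω.notMem_tail hT (by omega)
  rcases side_subset_or_disjoint (u := ω.toFun (n + 1)) (v := ω.toFun (n + 1 + 1)) hT (ω.adj n)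
    (fun h => h0 h.1) with h | h
  · exact h
  · exact (Set.disjoint_left.1 h (right_mem_side _ _) (ω.mem_tail hT (by omega))).elim

/-- A vertex `x` lies outside `ω.tail n` for all large `n`. -/
theorem GeodesicRay.notMem_tail_of_dist_le (ω : GeodesicRay T) (hT : T.IsTree) {x : V} {n : ℕ}
    (h : T.dist (ω.toFun 0) x ≤ n) : x ∉ ω.tail n := by
  intro hx
  have h1 := dist_add_one_add_dist_le hT (ω.adj n) (ω.notMem_tail hT (Nat.zero_le n)) hx
  rw [ω.dist_zero] at h1
  omega

theorem GeodesicRay.mem_range_of_tail_inter (hT : T.IsTree) {ω ω' : GeodesicRay T}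
    (h : ∀ n, (ω.tail n ∩ ω'.tail n).Nonempty) {n : ℕ}
    (hn : T.dist (ω.toFun 0) (ω'.toFun 0) ≤ n) : ω.toFun n ∈ ω'.range := by
  -- `ω'` starts outside `ω.tail n` and eventually lies inside, so it passes through `ω n`
  have h0 : ω'.toFun 0 ∉ ω.tail n := ω.notMem_tail_of_dist_le hT hn
  obtain ⟨m, hm1, hm2⟩ : ∃ m, T.dist (ω'.toFun 0) (ω.toFun n) ≤ m ∧
      T.dist (ω'.toFun 0) (ω.toFun (n + 1)) ≤ m := ⟨_, le_max_left _ _, le_max_right _ _⟩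
  have hsub : ω'.tail m ⊆ ω.tail n := by
    rcases side_nested hT (ω'.adj m) (ω.adj n) with h1 | h1 | h1 | h1
    · exact h1
    · exact absurd (h1 (right_mem_side _ _)) (ω'.notMem_tail_of_dist_le hT hm2)
    · obtain ⟨z, hz, hz'⟩ := h (max n m)
      exact (Set.disjoint_left.1 h1 (ω'.tail_antitone hT (le_max_right n m) hz')
        (ω.tail_antitone hT (le_max_left n m) hz)).elim
    · exact absurd (h1 (ω'.notMem_tail_of_dist_le hT hm1)) (ω.notMem_tail hT le_rfl)
  have hex : ∃ j, ω'.toFun j ∈ ω.tail n := ⟨m + 1, hsub (ω'.mem_tail hT (by omega))⟩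
  classical
  obtain ⟨j, hj⟩ : ∃ j, Nat.find hex = j + 1 := Nat.exists_eq_succ_of_ne_zero fun h1 => by
    have := Nat.find_spec hex
    rw [h1] at this
    exact h0 this
  have hspec := Nat.find_spec hex
  have hmin := Nat.find_min hex (m := j) (by omega)
  rw [hj] at hspec
  exact ⟨j, (eq_of_adj_of_notMem_side hT (ω'.adj j) (ω.adj n) hmin hspec).1⟩

/-- Two rays whose tails always meet define the same end. -/
theorem GeodesicRay.toBoundary_eq (hT : T.IsTree) {ω ω' : GeodesicRay T}
    (h : ∀ n, (ω.tail n ∩ ω'.tail n).Nonempty) : ω.toBoundary = ω'.toBoundary := by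
  refine Quotient.sound (s := raySetoid T) ?_
  change (symmDiff ω.range ω'.range).Finite
  have key : ∀ {η η' : GeodesicRay T}, (∀ n, (η.tail n ∩ η'.tail n).Nonempty) →
      (η.range \ η'.range).Finite := by
    intro η η' h
    refine ((Set.finite_Iio (T.dist (η.toFun 0) (η'.toFun 0))).image η.toFun).subset ?_
    rintro _ ⟨⟨n, rfl⟩, hn⟩
    refine ⟨n, ?_, rfl⟩
    by_contra hlt
    exact hn (mem_range_of_tail_inter hT h (not_lt.1 hlt))
  exact (key h).union (key fun n => by rw [Set.inter_comm]; exact h n)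

theorem side_subset_halfTree (hT : T.IsTree) (e : T.Dart) : side T e.fst e.snd ⊆ halfTree T e := by
  classical
  intro w hw
  obtain ⟨p⟩ : (T.deleteEdges {s(e.fst, e.snd)}).Reachable e.snd w := hw
  refine Or.inr ⟨(p.bypass).mapLe (SimpleGraph.deleteEdges_le _), ?_⟩
  rw [SimpleGraph.Walk.cons_isPath_iff]
  refine ⟨(SimpleGraph.Walk.isPath_mapLe _).2 p.bypass_isPath, fun hmem => ?_⟩
  rw [SimpleGraph.Walk.support_mapLe_eq_support] at hmem
  exact left_notMem_side hT e.adj ⟨p.bypass.takeUntil _ hmem⟩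

theorem halfTree_subset (e : T.Dart) :
    halfTree T e ⊆ insert e.fst (side T e.fst e.snd) := by
  rintro w (rfl | ⟨p, hp⟩)
  · exact Or.inl rfl
  · rw [SimpleGraph.Walk.cons_isPath_iff] at hp
    refine Or.inr (SimpleGraph.reachable_deleteEdges_iff_exists_walk.2 ⟨p, fun h => hp.2 ?_⟩)
    exact p.fst_mem_support_of_mem_edges h

/-- The tails of a ray contained in a half-tree are eventually contained in it. -/
theorem GeodesicRay.tail_subset_side (hT : T.IsTree) (e : T.Dart) {ω : GeodesicRay T}
    (hω : ω.range ⊆ halfTree T e) {n : ℕ} (hn : T.dist (ω.toFun 0) e.fst ≤ n) :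
    ω.tail n ⊆ side T e.fst e.snd := by
  have hfst : e.fst ∉ ω.tail n := ω.notMem_tail_of_dist_le hT hn
  have hmem : ω.toFun (n + 1) ∈ side T e.fst e.snd := by
    refine (halfTree_subset e (hω ⟨n + 1, rfl⟩)).resolve_left fun h => ?_
    rw [← h] at hfst
    exact hfst (ω.mem_tail hT (Nat.lt_succ_self n))
  rcases side_subset_or_disjoint (u := ω.toFun n) (v := ω.toFun (n + 1)) hT e.adj
    (fun h => hfst h.1) with h | h
  · exact h
  · exact (Set.disjoint_left.1 h (right_mem_side _ _) hmem).elim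

end Rays

/-! ### Actions on trees of general type -/

section TreeActions

variable {Γ V : Type*} [Group Γ] [MulAction Γ V] {T : SimpleGraph V} {ρ : Γ →* (T ≃g T)}

theorem adj_smul (hρ : ∀ g v, g • v = ρ g v) (g : Γ) {u v : V} (h : T.Adj u v) :
    T.Adj (g • u) (g • v) := by
  rw [hρ, hρ]
  exact (ρ g).map_adj_iff.2 h

theorem smul_side (hT : T.IsTree) (hρ : ∀ g v, g • v = ρ g v) (g : Γ) {u v : V} (h : T.Adj u v) :
    g • side T u v = side T (g • u) (g • v) := by
  ext w
  have hd : ∀ x, T.dist (g • x) w = T.dist x (g⁻¹ • w) := fun x => by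
    rw [← dist_aut (ρ g) x, ← hρ, ← hρ, smul_inv_smul]
  rw [Set.mem_smul_set_iff_inv_smul_mem, mem_side_iff hT h, mem_side_iff hT (adj_smul hρ g h),
    hd, hd]

/-- By minimality every orbit meets every half-tree: the convex hull of the orbit is an invariant
subtree. -/
theorem exists_smul_mem_side (hT : T.IsTree) (hρ : ∀ g v, g • v = ρ g v) (hmin : IsMinimalAction ρ)
    (v : V) {a b : V} (hab : T.Adj a b) : ∃ γ : Γ, γ • v ∈ side T a b := by
  by_contra! hno
  let S : Set V := {w | ∀ a b, T.Adj a b → (∀ γ : Γ, γ • v ∈ side T a b) → w ∈ side T a b}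
  have hv : v ∈ S := fun a b _ h => by simpa using h 1
  have hconn : (T.induce S).Connected := by
    have : Nonempty S := ⟨⟨v, hv⟩⟩
    refine ⟨fun x y => ?_⟩
    classical
    obtain ⟨p, hp⟩ := hT.connected.exists_walk_length_eq_dist x.1 y.1
    refine ⟨p.induce S fun z hz c d hcd h => ?_⟩
    refine mem_side_of_dist_add hT hcd (x.2 c d hcd h) (y.2 c d hcd h) (le_antisymm ?_ ?_)
    · have h1 := congrArg SimpleGraph.Walk.length (p.take_spec hz)
      rw [SimpleGraph.Walk.length_append] at h1
      have h2 := SimpleGraph.dist_le (p.takeUntil z hz)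
      have h3 := SimpleGraph.dist_le (p.dropUntil z hz)
      omega
    · exact hT.connected.dist_triangle
  have huniv := hmin S ⟨hconn, hT.isAcyclic.induce S⟩ (by
    intro g w hw c d hcd h
    rw [← hρ]
    have := hw (g⁻¹ • c) (g⁻¹ • d) (adj_smul hρ _ hcd) (fun γ => by
      rw [← smul_side hT hρ _ hcd, Set.mem_smul_set_iff_inv_smul_mem, inv_inv, smul_smul]
      exact h _)
    rwa [← smul_side hT hρ _ hcd, Set.mem_smul_set_iff_inv_smul_mem, inv_inv] at this)
  have hb : b ∈ S := huniv ▸ Set.mem_univ b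
  refine left_notMem_side hT hab.symm (hb b a hab.symm fun γ => ?_)
  exact (mem_side_or hT b a _).resolve_right (hno γ)

/-- Each edge can be moved so that one of its two sides lies in a given half-tree. -/
theorem exists_smul_side_subset (hT : T.IsTree) (hρ : ∀ g v, g • v = ρ g v)
    (hmin : IsMinimalAction ρ) {a b u v : V} (hab : T.Adj a b) (huv : T.Adj u v) :
    ∃ γ : Γ, γ • side T a b ⊆ side T u v ∨ γ • (side T a b)ᶜ ⊆ side T u v := by
  obtain ⟨γ, hγ⟩ := exists_smul_mem_side hT hρ hmin a huv
  refine ⟨γ, ?_⟩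
  rw [Set.smul_set_compl, smul_side hT hρ γ hab]
  rcases side_subset_or_disjoint (u := v) (v := u) hT (adj_smul hρ γ hab)
    (fun h => Set.disjoint_left.1 (disjoint_side hT huv) hγ h.1) with h | h
  · right
    rw [← compl_side hT huv] at h
    exact Set.compl_subset_comm.1 h
  · left
    rw [← compl_side hT huv] at h
    exact Set.disjoint_compl_left_iff_subset.1 h

/-- The positive half of a bi-infinite geodesic. -/
def axisRay {a : ℤ → V} (ha : ∀ i j : ℤ, (T.dist (a i) (a j) : ℤ) = |j - i|) : GeodesicRay T where
  toFun n := a n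
  dist_eq i j := ha i j

theorem axis_adj {a : ℤ → V} (ha : ∀ i j : ℤ, (T.dist (a i) (a j) : ℤ) = |j - i|) (n : ℤ) :
    T.Adj (a n) (a (n + 1)) := by
  rw [← SimpleGraph.dist_eq_one_iff_adj]
  have := ha n (n + 1)
  simpa using this

theorem axis_mem_side (hT : T.IsTree) {a : ℤ → V}
    (ha : ∀ i j : ℤ, (T.dist (a i) (a j) : ℤ) = |j - i|) {n m : ℤ} (h : n < m) :
    a m ∈ side T (a n) (a (n + 1)) := by
  rw [mem_side_iff hT (axis_adj ha n)]
  have h1 := ha n m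
  have h2 := ha (n + 1) m
  rw [abs_of_nonneg (by omega)] at h1 h2
  omega

theorem GeodesicRay.tail_map (hT : T.IsTree) (hρ : ∀ g v, g • v = ρ g v) (g : Γ)
    (ω : GeodesicRay T) (n : ℕ) : (ω.map (ρ g)).tail n = g • ω.tail n := by
  rw [GeodesicRay.tail, GeodesicRay.tail, smul_side hT hρ g (ω.adj n), hρ, hρ]
  rfl

theorem zpow_smul_axis {a : ℤ → V} {g : Γ} {l : ℤ} (hg : ∀ n, g • a n = a (n + l)) (k n : ℤ) :
    g ^ k • a n = a (n + k * l) := by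
  have hinv : ∀ n, g⁻¹ • a n = a (n - l) := fun n => by
    rw [inv_smul_eq_iff, hg, sub_add_cancel]
  induction k using Int.induction_on generalizing n with
  | zero => simp
  | succ k ih => rw [zpow_add_one, mul_smul, hg, ih]; congr 1; ring
  | pred k ih => rw [zpow_sub_one, mul_smul, hinv, ih]; congr 1; ring

/-- If `g` translates the axis `a` and `h` has no boundary fixed point in common with `g`, then some
group element moves the half-tree `side T (a 0) (a 1)` off itself. Indeed `g` fixes the end of `a`,
so `h` does not, and hence `h` moves the half-tree of a far edge of the axis off itself; a power of
`g` carries that edge to the edge from `a 0` to `a 1`. -/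
theorem exists_disjoint_smul_axis_side (hT : T.IsTree) (hρ : ∀ g v, g • v = ρ g v) {a : ℤ → V}
    (ha : ∀ i j : ℤ, (T.dist (a i) (a j) : ℤ) = |j - i|) {g h : Γ} {l : ℤ} (hl : l ≠ 0)
    (hg : ∀ n, g • a n = a (n + l))
    (hgh : ∀ ξ : Boundary T, ¬ (boundaryMap (ρ g) ξ = ξ ∧ boundaryMap (ρ h) ξ = ξ)) :
    ∃ γ : Γ, Disjoint (γ • side T (a 0) (a 1)) (side T (a 0) (a 1)) := by
  have htail : ∀ n : ℕ, (axisRay ha).tail n = side T (a n) (a (n + 1)) := fun n => by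
    simp [GeodesicRay.tail, axisRay]
  have hgfix : boundaryMap (ρ g) (axisRay ha).toBoundary = (axisRay ha).toBoundary := by
    refine GeodesicRay.toBoundary_eq (ω := (axisRay ha).map (ρ g)) hT fun n => ?_
    rw [GeodesicRay.tail_map hT hρ, htail]
    refine ⟨a (n + |l| + 1 + l), ?_, axis_mem_side hT ha ?_⟩
    · rw [← hg]
      exact Set.smul_mem_smul_set (axis_mem_side hT ha (by have := abs_nonneg l; omega))
    · have := neg_abs_le l
      omega
  obtain ⟨n, hn⟩ : ∃ n : ℕ, Disjoint (h • (axisRay ha).tail n) ((axisRay ha).tail n) := by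
    by_contra! hne
    refine hgh _ ⟨hgfix, GeodesicRay.toBoundary_eq (ω := (axisRay ha).map (ρ h)) hT fun n => ?_⟩
    rw [GeodesicRay.tail_map hT hρ]
    exact Set.not_disjoint_iff_nonempty_inter.1 (hne n)
  -- replace `n` by a multiple of the translation length
  have hnle : n ≤ l.natAbs * n := Nat.le_mul_of_pos_left n (Int.natAbs_pos.2 hl)
  have hsub := (axisRay ha).tail_antitone hT hnle
  replace hn := hn.mono (Set.smul_set_mono hsub) hsub
  have hk : (axisRay ha).tail (l.natAbs * n) = g ^ (l.sign * n) • side T (a 0) (a 1) := by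
    have hadj := axis_adj ha 0
    rw [zero_add] at hadj
    rw [htail, smul_side hT hρ _ hadj, zpow_smul_axis hg, zpow_smul_axis hg]
    have : ((l.natAbs * n : ℕ) : ℤ) = l.sign * n * l := by
      push_cast
      rw [← Int.sign_mul_self_eq_abs]
      ring
    rw [this]
    congr 2 <;> ring
  rw [hk] at hn
  refine ⟨(g ^ (l.sign * n))⁻¹ * h * g ^ (l.sign * n), ?_⟩
  rw [← Set.disjoint_smul_set (a := g ^ (l.sign * n))]
  simpa [smul_smul, mul_assoc] using hn

/-- For an action that is minimal and of general type, each half-tree can be mapped by a group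
element into each other half-tree. -/
theorem exists_smul_compl_side_subset (hT : T.IsTree) (hρ : ∀ g v, g • v = ρ g v)
    (hmin : IsMinimalAction ρ) (hgen : IsGeneralType ρ) {a b u v : V} (hab : T.Adj a b)
    (huv : T.Adj u v) : ∃ γ : Γ, γ • (side T a b)ᶜ ⊆ side T u v := by
  obtain ⟨g, h, ⟨x, hx, l, hl, hg⟩, -, hgh⟩ := hgen
  have hg' : ∀ n, g • x n = x (n + l) := fun n => by rw [hρ, hg]
  have hadj := axis_adj hx 0
  rw [zero_add] at hadj
  -- both sides `Q` and `Qᶜ` of an edge of the axis can be moved off themselves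
  set Q := side T (x 0) (x 1) with hQ
  obtain ⟨γ₁, h₁⟩ : ∃ γ : Γ, γ • Q ⊆ Qᶜ := by
    obtain ⟨γ, hγ⟩ := exists_disjoint_smul_axis_side hT hρ hx hl hg' hgh
    exact ⟨γ, Set.subset_compl_iff_disjoint_right.2 hγ⟩
  obtain ⟨γ₂, h₂⟩ : ∃ γ : Γ, γ • Qᶜ ⊆ Q := by
    obtain ⟨γ, hγ⟩ := exists_disjoint_smul_axis_side (a := fun n => x (1 - n)) (l := -l) hT hρ
      (fun i j => by rw [hx]; rw [abs_sub_comm]; congr 1; ring) (neg_ne_zero.2 hl)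
      (fun n => by rw [hg']; congr 1; ring) hgh
    refine ⟨γ, ?_⟩
    simp only [sub_zero, sub_self] at hγ
    rw [← compl_side hT hadj] at hγ
    exact Set.disjoint_compl_right_iff_subset.1 hγ
  -- hence both can be mapped into any half-tree
  have hboth : ∀ {u v : V}, T.Adj u v →
      (∃ γ : Γ, γ • Q ⊆ side T u v) ∧ ∃ γ : Γ, γ • Qᶜ ⊆ side T u v := by
    intro u v huv
    obtain ⟨γ, hγ | hγ⟩ := exists_smul_side_subset hT hρ hmin hadj huv
    · refine ⟨⟨γ, hγ⟩, γ * γ₂, ?_⟩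
      rw [mul_smul]
      exact (Set.smul_set_mono h₂).trans hγ
    · refine ⟨⟨γ * γ₁, ?_⟩, γ, hγ⟩
      rw [mul_smul]
      exact (Set.smul_set_mono h₁).trans hγ
  obtain ⟨γ, hγ⟩ := (hboth huv).1
  obtain ⟨γ', hγ'⟩ := (hboth hab).2
  refine ⟨γ * γ'⁻¹, ?_⟩
  have h3 : (side T a b)ᶜ ⊆ γ' • Q := by
    rw [Set.smul_set_compl] at hγ'
    exact Set.compl_subset_comm.1 hγ'
  rw [mul_smul]
  refine (Set.smul_set_mono ?_).trans hγ
  rw [Set.smul_set_subset_iff_subset_inv_smul_set, inv_inv]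
  exact h3

/-- Topological freeness in terms of half-trees: if `g` moves no half-tree inside the given one off
itself, then `g` fixes all ends of that half-tree. -/
theorem exists_disjoint_smul_side (hT : T.IsTree) (hρ : ∀ g v, g • v = ρ g v)
    (hmin : IsMinimalAction ρ) (hgen : IsGeneralType ρ) (hfree : IsTopologicallyFreeOnBoundary ρ)
    {g : Γ} (hg : g ≠ 1) {u v : V} (huv : T.Adj u v) : ∃ a b, T.Adj a b ∧
      side T a b ⊆ side T u v ∧ Disjoint (g • side T a b) (side T a b) := by
  by_contra! hno
  let e : T.Dart := ⟨(u, v), huv⟩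
  refine hg (hfree g (shadow T e) (TopologicalSpace.isOpen_generateFrom_of_mem ⟨e, rfl⟩) ?_ ?_)
  · obtain ⟨-, -, ⟨x, hx, -⟩, -⟩ := id hgen
    have hadj := axis_adj hx 0
    rw [zero_add] at hadj
    obtain ⟨γ, hγ⟩ := exists_smul_compl_side_subset hT hρ hmin hgen hadj.symm huv
    rw [compl_side hT hadj.symm] at hγ
    -- the translated ray, started one step later to lie within the half-tree
    have hx' : ∀ i j : ℤ, (T.dist (x (i + 1)) (x (j + 1)) : ℤ) = |j - i| := fun i j => by
      rw [hx]; congr 1; ring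
    refine ⟨_, (axisRay (a := fun n => x (n + 1)) hx').map (ρ γ), rfl, ?_⟩
    rintro _ ⟨n, rfl⟩
    refine side_subset_halfTree hT e (hγ ?_)
    refine ⟨x (n + 1), ?_, hρ _ _⟩
    have := axis_mem_side hT hx (n := 0) (m := n + 1) (by omega)
    rwa [zero_add] at this
  · rintro _ ⟨ω, rfl, hω⟩
    refine GeodesicRay.toBoundary_eq (ω := ω.map (ρ g)) hT fun n => ?_
    rw [GeodesicRay.tail_map hT hρ]
    have hle := ω.tail_antitone hT (le_max_left n (T.dist (ω.toFun 0) e.fst))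
    have h1 := hno _ _ (ω.adj _) (GeodesicRay.tail_subset_side hT e hω
      (le_max_right n (T.dist (ω.toFun 0) e.fst)))
    exact (Set.not_disjoint_iff_nonempty_inter.1 h1).mono
      (Set.inter_subset_inter (Set.smul_set_mono hle) hle)

/-- The half-trees form a half-space family. -/
theorem halfSpaceFamily_sides (hT : T.IsTree) (hρ : ∀ g v, g • v = ρ g v)
    (hmin : IsMinimalAction ρ) (hgen : IsGeneralType ρ) (hfree : IsTopologicallyFreeOnBoundary ρ) :
    HalfSpaceFamily Γ {H : Set V | ∃ u v, T.Adj u v ∧ side T u v = H} where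
  nonempty := by
    rintro _ ⟨u, v, -, rfl⟩
    exact ⟨v, right_mem_side u v⟩
  compl_mem := by
    rintro _ ⟨u, v, huv, rfl⟩
    exact ⟨v, u, huv.symm, (compl_side hT huv).symm⟩
  smul_mem := by
    rintro g _ ⟨u, v, huv, rfl⟩
    exact ⟨_, _, adj_smul hρ g huv, (smul_side hT hρ g huv).symm⟩
  nested := by
    rintro _ ⟨u, v, huv, rfl⟩ _ ⟨u', v', huv', rfl⟩
    exact side_nested hT huv huv'
  proximal := by
    rintro _ ⟨u, v, huv, rfl⟩ _ ⟨u', v', huv', rfl⟩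
    exact exists_smul_compl_side_subset hT hρ hmin hgen huv huv'
  displace := by
    rintro g hg _ ⟨u, v, huv, rfl⟩
    obtain ⟨a, b, hab, hsub, hd⟩ := exists_disjoint_smul_side hT hρ hmin hgen hfree hg huv
    exact ⟨_, ⟨a, b, hab, rfl⟩, hsub, hd⟩
  shift := by
    obtain ⟨g, -, ⟨x, hx, l, hl, hg⟩, -⟩ := hgen
    have hg' : ∀ n, g • x n = x (n + l) := fun n => by rw [hρ, hg]
    have hadj := axis_adj hx 0
    rw [zero_add] at hadj
    have hl0 : 0 < l.natAbs := Int.natAbs_pos.2 hl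
    have hpow : ∀ n, g ^ l.sign • x n = x (n + l.natAbs) := fun n => by
      rw [zpow_smul_axis hg', Int.sign_mul_self_eq_abs, Int.natCast_natAbs]
    refine ⟨g ^ l.sign, fun h1 => ?_, _, ⟨_, _, hadj, rfl⟩, ?_⟩
    · have h2 := hpow 0
      rw [h1, one_smul] at h2
      have h3 := hx 0 (0 + l.natAbs)
      rw [← h2, SimpleGraph.dist_self] at h3
      simp only [Int.natCast_natAbs, zero_add, sub_zero, abs_abs] at h3
      exact hl (abs_eq_zero.1 h3.symm)
    · rw [smul_side hT hρ _ hadj, hpow, hpow]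
      have h4 := (axisRay hx).tail_antitone hT (Nat.zero_le l.natAbs)
      simpa [GeodesicRay.tail, axisRay, add_comm] using h4
  gate := by
    refine ⟨T.dist, ?_⟩
    rintro _ ⟨u, v, huv, rfl⟩
    refine ⟨v, right_mem_side u v, fun x hx m hm => ?_, ?_⟩
    · have := dist_add_one_add_dist_le hT huv hx hm
      omega
    · rintro _ ⟨a, b, hab, rfl⟩ hsub hv
      have hu : u ∉ side T a b := fun h => left_notMem_side hT huv (hsub h)
      obtain ⟨rfl, rfl⟩ := eq_of_adj_of_notMem_side hT huv hab hu hv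
      rfl

end TreeActions

end TreeAct

theorem theoremA {Γ V : Type*} [Group Γ] [Countable Γ] (T : SimpleGraph V) (hT : T.IsTree)
    (ρ : Γ →* (T ≃g T)) (hmin : TreeAct.IsMinimalAction ρ) (hgen : TreeAct.IsGeneralType ρ)
    (hfree : TreeAct.IsTopologicallyFreeOnBoundary ρ) :
    (∃ (X : Type) (_ : Countable X) (_ : Infinite X) (_ : MulAction Γ X),
      TreeAct.IsHighlyTransitive Γ X ∧ TreeAct.IsHighlyFaithful Γ X) ∧
    TreeAct.IsHighlyTransitiveGroup Γ := by
  let _ : MulAction Γ V :=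
    { smul := fun g v => ρ g v
      one_smul := fun v => by change ρ 1 v = v; rw [map_one]; rfl
      mul_smul := fun g h v => by change ρ (g * h) v = ρ g (ρ h v); rw [map_mul]; rfl }
  obtain ⟨X, hc, hi, hX, ht, hf⟩ :=
    (TreeAct.halfSpaceFamily_sides hT (fun _ _ => rfl) hmin hgen hfree).exists_action
  refine ⟨⟨X, hc, hi, hX, ht, hf⟩, X, hc, hi, hX, ⟨fun {g h} hgh => ?_⟩, ht⟩
  by_contra hne
  have hne' : (1 : Γ) ∉ ({h⁻¹ * g} : Finset Γ) := by
    rw [Finset.mem_singleton, eq_comm, inv_mul_eq_one]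
    exact fun h' => hne h'.symm
  obtain ⟨x, hx⟩ := (hf _ hne').nonempty
  refine hx _ (Finset.mem_singleton_self _) ?_
  rw [mul_smul, hgh x, inv_smul_smul]
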